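/- Let $G$ be a discrete group with unit $e$ and let $\mathcal B=\{B_g\}_{g\in G}$ be a Fell bundle over $G$; thus $B_e$ is a $C^*$-algebra and $\bigoplus_{g\in G}B_g$ (finitely supported sections) is a $*$-algebra. Let $C^*(\mathcal B)$ be the completion of $\bigoplus_{g\in G} B_g$ in its largest $C^*$-seminorm, let $\ell^2(\mathcal B)$ be the Hilbert $B_e$-module obtained by completing $\bigoplus_{g\in G} B_g$ with respect to $\langle x,y\rangle=\sum_{g} x_g^*y_g$, let $C^*_r(\mathcal B)$ be the $C^*$-algebra generated by the operators of left multiplication by elements of $\bigoplus_{g\in G} B_g$ on $\ell^2(\mathcal B)$, and let $\Lambda:C^*(\mathcal B)\to C^*_r(\mathcal B)$ be the regular representation, i.e. the $*$-homomorphism that sends each element of $\bigoplus_{g\in G} B_g$ to left multiplication by it. The bundle $\mathcal B$ is called aperiodic if for each $t\in G\setminus\{e\}$, each $b_t\in B_t$ and every non-zero hereditary $C^*$-subalgebra $D$ of $B_e$, $$\inf\{\|d\,b_t\,d\| : d\in D^+,\ \|d\|=1\}=0.$$ Let $H$ be a Hilbert space and let $\Psi:C^*(\mathcal B)\to \mathcal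 B(H)$ be a representation ($*$-homomorphism) that is injective on $B_e$. (a) If $\mathcal B$ is aperiodic, then $\ker\Psi\subseteq\ker\Lambda$. (b) For an arbitrary Fell bundle $\mathcal B$ the following conditions are equivalent: (i) $\ker\Psi\subseteq\ker\Lambda$; (ii) $\|b_e\|\le\bigl\|\Psi\bigl(\bigoplus_{g\in G} b_g\bigr)\bigr\|$ for every $\bigoplus_{g\in G} b_g\in\bigoplus_{g\in G}B_g$; (iii) $\|b_e\|\le\bigl\|\Psi\bigl(\bigoplus_{g\in G} b_g\bigr)\bigr\|$ for every $\bigoplus_{g\in G} b_g\in\bigoplus_{g\in G}B_g$ that is positive in $C^*(\mathcal B)$. -/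

import Mathlib

/-! ### C*-seminorms on complex *-algebras and the C*-algebras they generate -/

/-- A C*-seminorm on a complex *-algebra. -/
structure CStarSeminorm (A : Type*) [NonUnitalRing A] [StarRing A] [Module ℂ A] extends
    Seminorm ℂ A where
  mul_le' : ∀ a b : A, toFun (a * b) ≤ toFun a * toFun b
  star' : ∀ a : A, toFun (star a) = toFun a
  star_mul_self' : ∀ a : A, toFun (star a * a) = toFun a ^ 2

namespace CStarSeminorm

section Basic

variable {A : Type*} [NonUnitalRing A] [StarRing A] [Module ℂ A]

noncomputable instance : CoeFun (CStarSeminorm A) (fun _ => A → ℝ) := ⟨fun p => p.toSeminorm⟩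

theorem mul_le (p : CStarSeminorm A) (a b : A) : p (a * b) ≤ p a * p b := p.mul_le' a b

theorem star_eq (p : CStarSeminorm A) (a : A) : p (star a) = p a := p.star' a

theorem star_mul_self (p : CStarSeminorm A) (a : A) : p (star a * a) = p a ^ 2 :=
  p.star_mul_self' a

/-- A copy of `A`, equipped with the topology of the C*-seminorm `p`. -/
def Pre (_p : CStarSeminorm A) : Type _ := A

variable (p : CStarSeminorm A)

noncomputable instance : NonUnitalRing p.Pre := inferInstanceAs (NonUnitalRing A)
noncomputable instance : StarRing p.Pre := inferInstanceAs (StarRing A)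
noncomputable instance : Module ℂ p.Pre := inferInstanceAs (Module ℂ A)
instance [StarModule ℂ A] : StarModule ℂ p.Pre := inferInstanceAs (StarModule ℂ A)
instance [IsScalarTower ℂ A A] : IsScalarTower ℂ p.Pre p.Pre :=
  inferInstanceAs (IsScalarTower ℂ A A)
instance [SMulCommClass ℂ A A] : SMulCommClass ℂ p.Pre p.Pre :=
  inferInstanceAs (SMulCommClass ℂ A A)

noncomputable instance : SeminormedAddCommGroup p.Pre :=
  fast_instance% p.toSeminorm.toAddGroupSeminorm.toSeminormedAddCommGroup

/-- The canonical identification of `A` with its copy. -/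
def toPre (a : A) : p.Pre := a

theorem norm_toPre (a : A) : ‖p.toPre a‖ = p a := rfl

noncomputable instance : NonUnitalSeminormedRing p.Pre :=
  { (inferInstance : SeminormedAddCommGroup p.Pre), (inferInstance : NonUnitalRing p.Pre) with
    norm_mul_le := fun a b => p.mul_le a b }

noncomputable instance : NormedSpace ℂ p.Pre where
  norm_smul_le c a := (map_smul_eq_mul p.toSeminorm c a).le

theorem norm_star_pre (a : p.Pre) : ‖star a‖ = ‖a‖ := p.star_eq a

noncomputable instance : NormedStarGroup p.Pre := ⟨fun a => (p.norm_star_pre a).le⟩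

end Basic

section Completion

variable {A : Type*} [NonUnitalRing A] [StarRing A] [Module ℂ A] (p : CStarSeminorm A)

/-- The Hausdorff completion of `A` in the C*-seminorm `p`, that is, the completion of
`A / {a | p a = 0}` in the norm induced by `p`. -/
def Completion : Type _ := UniformSpace.Completion p.Pre

noncomputable instance : NormedAddCommGroup p.Completion :=
  inferInstanceAs (NormedAddCommGroup (UniformSpace.Completion p.Pre))
noncomputable instance : NormedSpace ℂ p.Completion :=
  inferInstanceAs (NormedSpace ℂ (UniformSpace.Completion p.Pre))
instance : CompleteSpace p.Completion :=
  inferInstanceAs (CompleteSpace (UniformSpace.Completion p.Pre))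

/-- The canonical map from `A` to the completion. -/
noncomputable def of : p.Pre →L[ℂ] p.Completion :=
  UniformSpace.Completion.toComplL (𝕜 := ℂ) (E := p.Pre)

theorem norm_of (a : p.Pre) : ‖p.of a‖ = ‖a‖ := UniformSpace.Completion.norm_coe a

theorem denseRange_of : DenseRange p.of := UniformSpace.Completion.denseRange_coe

theorem isDenseInducing_of : IsDenseInducing p.of :=
  UniformSpace.Completion.isDenseInducing_coe

theorem isUniformInducing_of : IsUniformInducing p.of :=
  UniformSpace.Completion.isUniformInducing_coe p.Pre

/-- The product of the completion is the continuous extension of the product of `A`. -/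
noncomputable instance : Mul p.Completion :=
  ⟨fun x y => (p.isDenseInducing_of.prodMap p.isDenseInducing_of).extend
    (fun z : p.Pre × p.Pre => p.of (z.1 * z.2)) (x, y)⟩

/-- The involution of the completion is the continuous extension of the involution of `A`. -/
noncomputable instance : Star p.Completion :=
  ⟨p.isDenseInducing_of.extend fun a : p.Pre => p.of (star a)⟩

theorem of_mul (a b : p.Pre) : p.of (a * b) = p.of a * p.of b := by
  refine ((p.isDenseInducing_of.prodMap p.isDenseInducing_of).extend_eq
    (f := fun z : p.Pre × p.Pre => p.of (z.1 * z.2)) ?_ (a, b)).symm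
  exact p.of.continuous.comp continuous_mul

theorem of_star (a : p.Pre) : p.of (star a) = star (p.of a) :=
  (p.isDenseInducing_of.extend_eq (f := fun a : p.Pre => p.of (star a))
    (p.of.continuous.comp continuous_star) a).symm

theorem continuous_mul_completion :
    Continuous fun z : p.Completion × p.Completion => z.1 * z.2 := by
  let m := (AddMonoidHom.mul : p.Pre →+ p.Pre →+ p.Pre).compr₂ (p.of : p.Pre →+ p.Completion)
  have h : Continuous fun z : p.Pre × p.Pre => m z.1 z.2 :=
    p.of.continuous.comp continuous_mul
  exact IsDenseInducing.extend_Z_bilin (e := (p.of : p.Pre →+ p.Completion))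
    (f := (p.of : p.Pre →+ p.Completion)) p.isDenseInducing_of p.isDenseInducing_of h

instance : ContinuousMul p.Completion := ⟨p.continuous_mul_completion⟩

theorem continuous_star_completion : Continuous fun x : p.Completion => star x := by
  let s : p.Pre →+ p.Completion := (p.of : p.Pre →+ p.Completion).comp
    (starAddEquiv : p.Pre ≃+ p.Pre).toAddMonoidHom
  have h : Continuous s := p.of.continuous.comp continuous_star
  exact (uniformContinuous_uniformly_extend p.isUniformInducing_of p.denseRange_of
    (uniformContinuous_addMonoidHom_of_continuous h)).continuous

instance : ContinuousStar p.Completion := ⟨p.continuous_star_completion⟩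

section

theorem smul_mul_completion [IsScalarTower ℂ A A] (c : ℂ) (x y : p.Completion) :
    (c • x) * y = c • (x * y) := by
  have hc : Continuous fun x : p.Completion => c • x := continuous_const_smul c
  refine p.denseRange_of.induction_on₂ (p := fun x y => (c • x) * y = c • (x * y))
    (isClosed_eq ((hc.comp continuous_fst).mul continuous_snd) (hc.comp continuous_mul)) (fun a b => ?_) x y
  rw [← of_mul, ← ContinuousLinearMap.map_smul, ← ContinuousLinearMap.map_smul, ← of_mul,
    smul_mul_assoc]

theorem mul_smul_completion [SMulCommClass ℂ A A] (c : ℂ) (x y : p.Completion) :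
    x * (c • y) = c • (x * y) := by
  have hc : Continuous fun x : p.Completion => c • x := continuous_const_smul c
  refine p.denseRange_of.induction_on₂ (p := fun x y => x * (c • y) = c • (x * y))
    (isClosed_eq (continuous_fst.mul (hc.comp continuous_snd)) (hc.comp continuous_mul)) (fun a b => ?_) x y
  rw [← of_mul, ← ContinuousLinearMap.map_smul, ← ContinuousLinearMap.map_smul, ← of_mul,
    mul_smul_comm]

theorem star_smul_completion [StarModule ℂ A] (c : ℂ) (x : p.Completion) :
    star (c • x) = star c • star x := by
  have hc : Continuous fun x : p.Completion => c • x := continuous_const_smul c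
  refine p.denseRange_of.induction_on x (isClosed_eq (continuous_star.comp hc)
    ((continuous_const_smul (star c)).comp continuous_star)) fun a => ?_
  rw [← of_star, ← ContinuousLinearMap.map_smul, ← ContinuousLinearMap.map_smul, ← of_star,
    star_smul]

end

noncomputable instance : NonUnitalNormedRing p.Completion :=
  { (inferInstance : NormedAddCommGroup p.Completion), (inferInstance : Mul p.Completion) with
    zero_mul := fun x => by
      refine p.denseRange_of.induction_on x (isClosed_eq (by fun_prop) (by fun_prop)) fun a => ?_
      rw [← map_zero p.of, ← of_mul, zero_mul]
    mul_zero := fun x => by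
      refine p.denseRange_of.induction_on x (isClosed_eq (by fun_prop) (by fun_prop)) fun a => ?_
      rw [← map_zero p.of, ← of_mul, mul_zero]
    mul_assoc := fun x y z => by
      refine p.denseRange_of.induction_on₃ (p := fun x y z => x * y * z = x * (y * z))
        (isClosed_eq (by fun_prop) (by fun_prop)) (fun a b c => ?_) x y z
      simp only [← of_mul, mul_assoc]
    left_distrib := fun x y z => by
      refine p.denseRange_of.induction_on₃ (p := fun x y z => x * (y + z) = x * y + x * z)
        (isClosed_eq (by fun_prop) (by fun_prop)) (fun a b c => ?_) x y z
      simp only [← of_mul, ← map_add, mul_add]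
    right_distrib := fun x y z => by
      refine p.denseRange_of.induction_on₃ (p := fun x y z => (x + y) * z = x * z + y * z)
        (isClosed_eq (by fun_prop) (by fun_prop)) (fun a b c => ?_) x y z
      simp only [← of_mul, ← map_add, add_mul]
    norm_mul_le := fun x y => by
      refine p.denseRange_of.induction_on₂ (p := fun x y => ‖x * y‖ ≤ ‖x‖ * ‖y‖)
        (isClosed_le (by fun_prop) (by fun_prop)) (fun a b => ?_) x y
      simp only [← of_mul, norm_of]
      exact norm_mul_le a b }

noncomputable instance : StarRing p.Completion where
  star_involutive x := by
    refine p.denseRange_of.induction_on x (isClosed_eq (by fun_prop) (by fun_prop)) fun a => ?_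
    simp only [← of_star, star_star]
  star_mul x y := by
    refine p.denseRange_of.induction_on₂ (p := fun x y => star (x * y) = star y * star x)
      (isClosed_eq (by fun_prop) (by fun_prop)) (fun a b => ?_) x y
    simp only [← of_star, ← of_mul, star_mul]
  star_add x y := by
    refine p.denseRange_of.induction_on₂ (p := fun x y => star (x + y) = star x + star y)
      (isClosed_eq (by fun_prop) (by fun_prop)) (fun a b => ?_) x y
    simp only [← of_star, ← map_add, star_add]

instance : CStarRing p.Completion where
  norm_mul_self_le x := by
    refine p.denseRange_of.induction_on x (isClosed_le (by fun_prop) (by fun_prop)) fun a => ?_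
    simp only [← of_star, ← of_mul, norm_of]
    exact (by rw [← sq]; exact (p.star_mul_self a).symm.le)

/-- The canonical *-homomorphism from `A` to its completion in the C*-seminorm `p`. -/
noncomputable def ι : A →⋆ₙₐ[ℂ] p.Completion where
  toFun a := p.of (p.toPre a)
  map_smul' c a := map_smul p.of c (p.toPre a)
  map_zero' := map_zero p.of
  map_add' a b := map_add p.of (p.toPre a) (p.toPre b)
  map_mul' a b := p.of_mul (p.toPre a) (p.toPre b)
  map_star' a := p.of_star (p.toPre a)

theorem norm_ι (a : A) : ‖p.ι a‖ = p a := p.norm_of (p.toPre a)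

theorem denseRange_ι : DenseRange p.ι := p.denseRange_of

section

variable [StarModule ℂ A] [IsScalarTower ℂ A A] [SMulCommClass ℂ A A]

noncomputable instance : NonUnitalCStarAlgebra p.Completion where
  smul_assoc := p.smul_mul_completion
  smul_comm c x y := (p.mul_smul_completion c x y).symm
  star_smul := p.star_smul_completion

end

/-- If `q ≤ p`, then the identity map of `A` extends to a *-homomorphism from the completion
in `p` to the completion in `q`. -/
noncomputable def map {p q : CStarSeminorm A} (h : ∀ a, q a ≤ p a) :
    p.Completion →⋆ₙₐ[ℂ] q.Completion :=
  let j : p.Pre →L[ℂ] q.Completion :=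
    LinearMap.mkContinuous
      { toFun := fun a => q.ι a
        map_add' := fun a b => map_add q.ι a b
        map_smul' := fun c a => map_smul q.ι c a } 1
      (fun a => by rw [one_mul]; exact (q.norm_ι a).le.trans (h a))
  let J : p.Completion →L[ℂ] q.Completion := j.extend p.of
  have hJ : ∀ a : A, J (p.ι a) = q.ι a := fun a =>
    ContinuousLinearMap.extend_eq j p.denseRange_of p.isUniformInducing_of a
  { J with
    map_zero' := map_zero J
    map_mul' := fun x y => by
      refine p.denseRange_ι.induction_on₂ (p := fun x y => J (x * y) = J x * J y)
        (isClosed_eq (by fun_prop) (by fun_prop)) (fun a b => ?_) x y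
      rw [← map_mul, hJ, hJ, hJ, map_mul]
    map_star' := fun x => by
      refine p.denseRange_ι.induction_on (p := fun x => J (star x) = star (J x))
        x (isClosed_eq (by fun_prop) (by fun_prop)) (fun a => ?_)
      rw [← map_star, hJ, hJ, map_star] }

theorem map_ι {p q : CStarSeminorm A} (h : ∀ a, q a ≤ p a) (a : A) :
    map h (p.ι a) = q.ι a :=
  ContinuousLinearMap.extend_eq _ p.denseRange_of p.isUniformInducing_of a

end Completion

/-- Every C*-seminorm on a C*-algebra is dominated by the norm. -/
theorem le_norm {A : Type*} [NonUnitalCStarAlgebra A] (p : CStarSeminorm A) (a : A) :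
    p a ≤ ‖a‖ := by
  rw [← p.norm_ι a]
  exact NonUnitalStarAlgHom.norm_apply_le p.ι a

end CStarSeminorm

/-! ### Fell bundles over discrete groups -/

/-- A Fell bundle over the discrete group `G`: a family of complex Banach spaces `B g`, with
multiplication maps `B g × B h → B (g * h)` and involutions `B g → B g⁻¹`. To avoid transports along
equalities in `G`, the multiplication takes values in `B k` for any `k` with `g * h = k`, and
likewise for the involution. -/
class FellBundle {G : Type*} [Group G] (B : G → Type*) [∀ g, NormedAddCommGroup (B g)]
    [∀ g, NormedSpace ℂ (B g)] where
  complete (g : G) : CompleteSpace (B g)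
  mul {g h k : G} (e : g * h = k) (a : B g) (b : B h) : B k
  add_mul {g h k : G} (e : g * h = k) (a a' : B g) (b : B h) :
    mul e (a + a') b = mul e a b + mul e a' b
  mul_add {g h k : G} (e : g * h = k) (a : B g) (b b' : B h) :
    mul e a (b + b') = mul e a b + mul e a b'
  smul_mul {g h k : G} (e : g * h = k) (c : ℂ) (a : B g) (b : B h) :
    mul e (c • a) b = c • mul e a b
  mul_smul {g h k : G} (e : g * h = k) (c : ℂ) (a : B g) (b : B h) :
    mul e a (c • b) = c • mul e a b
  mul_assoc {g h k gh hk ghk : G} (e₁ : g * h = gh) (e₂ : gh * k = ghk) (e₃ : h * k = hk)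
    (e₄ : g * hk = ghk) (a : B g) (b : B h) (c : B k) :
    mul e₂ (mul e₁ a b) c = mul e₄ a (mul e₃ b c)
  norm_mul_le {g h k : G} (e : g * h = k) (a : B g) (b : B h) : ‖mul e a b‖ ≤ ‖a‖ * ‖b‖
  star {g h : G} (e : g⁻¹ = h) (a : B g) : B h
  star_add {g h : G} (e : g⁻¹ = h) (a b : B g) : star e (a + b) = star e a + star e b
  star_smul {g h : G} (e : g⁻¹ = h) (c : ℂ) (a : B g) :
    star e (c • a) = (starRingEnd ℂ) c • star e a
  star_star {g h : G} (e : g⁻¹ = h) (e' : h⁻¹ = g) (a : B g) : star e' (star e a) = a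
  star_mul {g h k g' h' k' : G} (e : g * h = k) (eg : g⁻¹ = g') (eh : h⁻¹ = h') (ek : k⁻¹ = k')
    (e' : h' * g' = k') (a : B g) (b : B h) :
    star ek (mul e a b) = mul e' (star eh b) (star eg a)
  norm_star {g h : G} (e : g⁻¹ = h) (a : B g) : ‖star e a‖ = ‖a‖
  norm_star_mul_self {g h : G} (e : g⁻¹ = h) (e' : h * g = 1) (a : B g) :
    ‖mul e' (star e a) a‖ = ‖a‖ ^ 2
  /-- `a* a` is a positive element of the C*-algebra `B 1`, for every `a ∈ B g` -/
  star_mul_self_pos {g h : G} (e : g⁻¹ = h) (e' : h * g = 1) (a : B g) :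
    ∃ b : B 1, mul e' (star e a) a = mul (one_mul 1) (star inv_one b) b

namespace FellBundle

section Defs

set_option linter.unusedSectionVars false

variable {G : Type*} [Group G] (B : G → Type*) [∀ g, NormedAddCommGroup (B g)]
  [∀ g, NormedSpace ℂ (B g)]

/-- The fibre `B_e` over the unit element. -/
def UnitFibre : Type _ := B 1

noncomputable instance : NormedAddCommGroup (UnitFibre B) :=
  inferInstanceAs (NormedAddCommGroup (B 1))
noncomputable instance : NormedSpace ℂ (UnitFibre B) := inferInstanceAs (NormedSpace ℂ (B 1))

/-- The space `⨁ g, B g` of finitely supported sections. -/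
def Sections : Type _ := Π₀ g, B g

noncomputable instance : AddCommGroup (Sections B) := inferInstanceAs (AddCommGroup (Π₀ g, B g))
noncomputable instance : Module ℂ (Sections B) := inferInstanceAs (Module ℂ (Π₀ g, B g))
instance : DFunLike (Sections B) G B := inferInstanceAs (DFunLike (Π₀ g, B g) G B)

variable {B}

open scoped Classical in
/-- The section supported at `g` with value `a` there. -/
noncomputable def single (g : G) : B g →ₗ[ℂ] Sections B := DFinsupp.lsingle g

theorem single_apply_self (g : G) (a : B g) : single g a g = a := by
  classical
  exact DFinsupp.single_eq_same

theorem single_apply_ne {g h : G} (hgh : h ≠ g) (a : B g) : single g a h = 0 := by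
  classical
  exact DFinsupp.single_eq_of_ne hgh

theorem add_apply (f f' : Sections B) (g : G) : (f + f') g = f g + f' g := rfl

theorem smul_apply (c : ℂ) (f : Sections B) (g : G) : (c • f) g = c • f g := rfl

theorem zero_apply (g : G) : (0 : Sections B) g = 0 := rfl

theorem Sections.ext {f f' : Sections B} (h : ∀ g, f g = f' g) : f = f' := DFinsupp.ext h

theorem Sections.induction {P : Sections B → Prop} (f : Sections B) (zero : P 0)
    (add : ∀ f f', P f → P f' → P (f + f')) (single : ∀ g a, P (single g a)) : P f := by
  classical
  exact DFinsupp.induction f zero fun g a f' _ _ h => add _ _ (single g a) h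

open scoped Classical in
/-- The linear map on sections induced by a family of linear maps on the fibres. -/
noncomputable def lift {N : Type*} [AddCommGroup N] [Module ℂ N] (F : ∀ g, B g →ₗ[ℂ] N) :
    Sections B →ₗ[ℂ] N :=
  DFinsupp.lsum ℂ F

theorem lift_single {N : Type*} [AddCommGroup N] [Module ℂ N] (F : ∀ g, B g →ₗ[ℂ] N) (g : G)
    (a : B g) : lift F (single g a) = F g a := by
  classical
  exact DFinsupp.lsum_single ℂ F g a

end Defs

section Algebra

variable {G : Type*} [Group G] {B : G → Type*} [∀ g, NormedAddCommGroup (B g)]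
  [∀ g, NormedSpace ℂ (B g)] [FellBundle B]

noncomputable instance : Mul (UnitFibre B) := ⟨fun a b => mul (B := B) (one_mul 1) a b⟩
noncomputable instance : Star (UnitFibre B) := ⟨fun a => star (B := B) inv_one a⟩

/-- The unit fibre of a Fell bundle is a C*-algebra. -/
noncomputable instance : NonUnitalCStarAlgebra (UnitFibre B) where
  __ := (inferInstance : NormedAddCommGroup (UnitFibre B))
  __ := (inferInstance : NormedSpace ℂ (UnitFibre B))
  __ := (inferInstance : Mul (UnitFibre B))
  __ := (inferInstance : Star (UnitFibre B))
  left_distrib a b c := mul_add (B := B) _ a b c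
  right_distrib a b c := add_mul (B := B) _ a b c
  zero_mul a := by
    have h := smul_mul (B := B) (one_mul 1) 0 (0 : B 1) a
    rwa [zero_smul, zero_smul] at h
  mul_zero a := by
    have h := mul_smul (B := B) (one_mul 1) 0 a (0 : B 1)
    rwa [zero_smul, zero_smul] at h
  mul_assoc a b c := mul_assoc (B := B) _ _ _ _ a b c
  norm_mul_le a b := norm_mul_le (B := B) _ a b
  star_involutive a := star_star (B := B) _ _ a
  star_mul a b := star_mul (B := B) _ _ _ _ _ a b
  star_add a b := star_add (B := B) _ a b
  complete := (complete (B := B) 1).complete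
  norm_mul_self_le a := ((norm_star_mul_self (B := B) inv_one (one_mul 1) a).trans (sq _)).ge
  smul_assoc c a b := smul_mul (B := B) _ c a b
  smul_comm c a b := (mul_smul (B := B) _ c a b).symm
  star_smul c a := star_smul (B := B) _ c a

/-- The multiplication of a Fell bundle as a bilinear map. -/
noncomputable def mulₗ (g h : G) : B g →ₗ[ℂ] B h →ₗ[ℂ] B (g * h) :=
  LinearMap.mk₂ ℂ (mul rfl) (add_mul rfl) (smul_mul rfl) (mul_add rfl) (mul_smul rfl)

/-- The product of sections, the bilinear extension of the multiplication of the bundle. -/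
noncomputable def sectionMul : Sections B →ₗ[ℂ] Sections B →ₗ[ℂ] Sections B :=
  lift fun g => LinearMap.flip (lift fun h =>
    LinearMap.flip ((mulₗ g h).compr₂ (single (g * h))))

noncomputable instance : Mul (Sections B) := ⟨fun f f' => sectionMul f f'⟩

theorem single_mul_single {g h k : G} (e : g * h = k) (a : B g) (b : B h) :
    single g a * single h b = single k (mul e a b) := by
  subst e
  change sectionMul (single g a) (single h b) = _
  simp only [sectionMul, lift_single, LinearMap.flip_apply, LinearMap.compr₂_apply]
  rfl

noncomputable instance : NonUnitalNonAssocRing (Sections B) where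
  left_distrib f f₁ f₂ := map_add (sectionMul f) f₁ f₂
  right_distrib f f₁ f₂ := LinearMap.map_add₂ sectionMul f f₁ f₂
  zero_mul f := LinearMap.map_zero₂ sectionMul f
  mul_zero f := map_zero (sectionMul f)

noncomputable instance : NonUnitalRing (Sections B) where
  mul_assoc f₁ f₂ f₃ := by
    induction f₁ using Sections.induction with
    | zero => simp
    | add f f' h h' => simp only [_root_.add_mul, h, h']
    | single g a =>
      induction f₂ using Sections.induction with
      | zero => simp
      | add f f' h h' => simp only [_root_.add_mul, _root_.mul_add, h, h']
      | single h b =>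
        induction f₃ using Sections.induction with
        | zero => simp
        | add f f' h h' => simp only [_root_.mul_add, h, h']
        | single k c =>
          rw [single_mul_single rfl, single_mul_single rfl, single_mul_single rfl,
            single_mul_single (_root_.mul_assoc g h k).symm,
            mul_assoc rfl rfl rfl (_root_.mul_assoc g h k).symm]

instance : IsScalarTower ℂ (Sections B) (Sections B) where
  smul_assoc c f f' := LinearMap.map_smul₂ sectionMul c f f'

instance : SMulCommClass ℂ (Sections B) (Sections B) where
  smul_comm c f f' := (map_smul (sectionMul f) c f').symm

/-- The involution of the fibre at `g` followed by the inclusion into the sections. -/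
noncomputable def starAddHom (g : G) : B g →+ Sections B where
  toFun a := single g⁻¹ (star rfl a)
  map_zero' := by
    have h := star_smul (B := B) (rfl : g⁻¹ = g⁻¹) 0 0
    rw [zero_smul, map_zero, zero_smul] at h
    rw [h, map_zero]
  map_add' a b := by rw [star_add, map_add]

open scoped Classical in
/-- The involution of sections, the additive extension of the involution of the bundle. -/
noncomputable def sectionStar : Sections B →+ Sections B := DFinsupp.liftAddHom starAddHom

noncomputable instance : Star (Sections B) := ⟨fun f => sectionStar f⟩

theorem star_single {g h : G} (e : g⁻¹ = h) (a : B g) :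
    Star.star (single g a) = single h (star e a) := by
  subst e
  classical
  exact DFinsupp.liftAddHom_apply_single starAddHom g a

theorem star_add_section (f f' : Sections B) :
    Star.star (f + f') = Star.star f + Star.star f' := map_add sectionStar f f'

theorem star_zero_section : Star.star (0 : Sections B) = 0 := map_zero sectionStar

noncomputable instance : StarRing (Sections B) where
  star_involutive f := by
    induction f using Sections.induction with
    | zero => rw [star_zero_section, star_zero_section]
    | add f f' h h' => rw [star_add_section, star_add_section, h, h']
    | single g a =>
      rw [star_single rfl, star_single (inv_inv g), star_star]
  star_add := star_add_section
  star_mul f f' := by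
    induction f using Sections.induction with
    | zero => simp only [zero_mul, star_zero_section, mul_zero]
    | add f₁ f₂ h₁ h₂ => simp only [_root_.add_mul, star_add_section, _root_.mul_add, h₁, h₂]
    | single g a =>
      induction f' using Sections.induction with
      | zero => simp only [zero_mul, star_zero_section, mul_zero]
      | add f₁ f₂ h₁ h₂ => simp only [_root_.add_mul, star_add_section, _root_.mul_add, h₁, h₂]
      | single h b =>
        rw [single_mul_single rfl, star_single rfl, star_single rfl, star_single rfl,
          single_mul_single (mul_inv_rev g h).symm, star_mul rfl rfl rfl rfl]

instance : StarModule ℂ (Sections B) where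
  star_smul c f := by
    induction f using Sections.induction with
    | zero => simp only [smul_zero, star_zero]
    | add f f' h h' => simp only [smul_add, star_add_section, h, h']
    | single g a =>
      rw [← map_smul, star_single rfl, star_single rfl, star_smul, map_smul]
      rfl

/-- The `B_e`-valued inner product `⟨x, y⟩ = ∑ g, (x g)* (y g)` of finitely supported sections. -/
noncomputable def inner (x y : Sections B) : UnitFibre B :=
  ∑ᶠ g, (mul (inv_mul_cancel g) (star rfl (x g)) (y g) : B 1)

theorem mul_zero_fibre {g h k : G} (e : g * h = k) (a : B g) : mul e a (0 : B h) = 0 := by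
  have h := mul_smul e 0 a (0 : B h)
  rwa [zero_smul, zero_smul] at h

theorem zero_mul_fibre {g h k : G} (e : g * h = k) (b : B h) : mul e (0 : B g) b = 0 := by
  have h := smul_mul e 0 (0 : B g) b
  rwa [zero_smul, zero_smul] at h

theorem star_zero_fibre {g h : G} (e : g⁻¹ = h) : star e (0 : B g) = 0 := by
  have h := star_smul e 0 (0 : B g)
  rwa [zero_smul, map_zero, zero_smul] at h

theorem finite_support_left (x y : Sections B) : (Function.support fun g =>
    (mul (inv_mul_cancel g) (star rfl (x g)) (y g) : B 1)).Finite := by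
  refine (DFinsupp.finite_support x).subset fun g hg h => hg ?_
  have h' : x g = 0 := h
  simp only [h', star_zero_fibre, zero_mul_fibre]

theorem inner_add_left (x x' y : Sections B) : inner (x + x') y = inner x y + inner x' y := by
  refine Eq.trans (finsum_congr fun g => ?_)
    (finsum_add_distrib (finite_support_left x y) (finite_support_left x' y))
  rw [add_apply, star_add, add_mul]
  rfl

theorem inner_add_right (x y y' : Sections B) : inner x (y + y') = inner x y + inner x y' := by
  refine Eq.trans (finsum_congr fun g => ?_)
    (finsum_add_distrib (finite_support_left x y) (finite_support_left x y'))
  rw [add_apply, mul_add]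
  rfl

/-- Evaluation of a section at the unit element. -/
def evalUnit (f : Sections B) : UnitFibre B := f 1

theorem evalUnit_add (f f' : Sections B) : evalUnit (f + f') = evalUnit f + evalUnit f' := rfl

theorem evalUnit_sub (f f' : Sections B) : evalUnit (f - f') = evalUnit f - evalUnit f' := rfl

theorem evalUnit_smul (c : ℂ) (f : Sections B) : evalUnit (c • f) = c • evalUnit f := rfl

theorem inner_eq (x y : Sections B) : inner x y = evalUnit (Star.star x * y) := by
  induction x using Sections.induction with
  | zero =>
    rw [star_zero_section, zero_mul]
    refine (finsum_congr fun g => ?_).trans finsum_zero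
    rw [zero_apply, star_zero_fibre, zero_mul_fibre]
    rfl
  | add f f' h h' => rw [inner_add_left, star_add_section, _root_.add_mul, h, h', evalUnit_add]
  | single g a =>
    induction y using Sections.induction with
    | zero =>
      rw [mul_zero]
      refine (finsum_congr fun g => ?_).trans finsum_zero
      rw [zero_apply, mul_zero_fibre]
      rfl
    | add f f' h h' => rw [inner_add_right, _root_.mul_add, h, h', evalUnit_add]
    | single h b =>
      rw [star_single rfl]
      refine (finsum_eq_single _ h fun k hk => ?_).trans ?_
      · rw [single_apply_ne hk, mul_zero_fibre]
        rfl
      · rw [single_apply_self]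
        by_cases hgh : g = h
        · subst hgh
          rw [single_mul_single (inv_mul_cancel g), single_apply_self]
          exact (single_apply_self 1 _).symm
        · rw [single_apply_ne (Ne.symm hgh), star_zero_fibre, zero_mul_fibre,
            single_mul_single rfl]
          refine (single_apply_ne (fun h1 => hgh ?_) _).symm
          exact inv_mul_eq_one.mp h1.symm

/-- The inclusion of the unit fibre into the *-algebra of sections. -/
noncomputable def unitHom : UnitFibre B →⋆ₙₐ[ℂ] Sections B where
  toFun a := single 1 (a : B 1)
  map_smul' c a := map_smul (single 1) c (a : B 1)
  map_zero' := map_zero (single (B := B) 1)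
  map_add' a b := map_add (single 1) (a : B 1) (b : B 1)
  map_mul' a b := (single_mul_single (B := B) (one_mul 1) a b).symm
  map_star' a := (star_single (B := B) inv_one a).symm

theorem mul_single_one_apply (f : Sections B) (b : B 1) :
    (f * single 1 b) 1 = mul (one_mul 1) (f 1) b := by
  induction f using Sections.induction with
  | zero => rw [zero_mul, zero_apply, zero_mul_fibre]
  | add f f' h h' => rw [_root_.add_mul, add_apply, h, h', add_apply, add_mul]
  | single g a =>
    by_cases hg : g = 1
    · subst hg
      rw [single_mul_single (one_mul 1), single_apply_self, single_apply_self]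
    · rw [single_mul_single rfl, single_apply_ne, single_apply_ne (Ne.symm hg), zero_mul_fibre]
      intro h
      exact hg (by rw [h, mul_one])

theorem star_apply_one (f : Sections B) : (Star.star f) 1 = star inv_one (f 1) := by
  induction f using Sections.induction with
  | zero => rw [star_zero_section, zero_apply, star_zero_fibre]
  | add f f' h h' => rw [star_add_section, add_apply, h, h', add_apply, star_add]
  | single g a =>
    by_cases hg : g = 1
    · subst hg
      rw [star_single inv_one, single_apply_self, single_apply_self]
    · rw [star_single rfl, single_apply_ne, single_apply_ne (Ne.symm hg), star_zero_fibre]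
      exact fun h => hg (inv_eq_one.mp h.symm)

theorem evalUnit_mul_unitHom (f : Sections B) (b : UnitFibre B) :
    evalUnit (f * unitHom b) = evalUnit f * b := mul_single_one_apply f b

theorem evalUnit_star (f : Sections B) : evalUnit (Star.star f) = Star.star (evalUnit f) :=
  star_apply_one f

theorem evalUnit_unitHom_mul (b : UnitFibre B) (f : Sections B) :
    evalUnit (unitHom b * f) = b * evalUnit f := by
  rw [← _root_.star_star (unitHom b * f), StarMul.star_mul, evalUnit_star, ← map_star,
    evalUnit_mul_unitHom, StarMul.star_mul, evalUnit_star, _root_.star_star, _root_.star_star]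

theorem star_inner (x y : Sections B) : Star.star (inner x y) = inner y x := by
  rw [inner_eq, inner_eq, ← evalUnit_star, StarMul.star_mul, _root_.star_star]

section Order

attribute [local instance] CStarAlgebra.spectralOrder CStarAlgebra.spectralOrderedRing

theorem inner_self_nonneg (x : Sections B) : 0 ≤ inner x x := by
  refine finsum_nonneg (M := UnitFibre B) fun g => ?_
  obtain ⟨b, hb⟩ := star_mul_self_pos rfl (inv_mul_cancel g) (x g)
  have h := star_mul_self_nonneg (R := UnitFibre B) b
  exact h.trans_eq hb.symm

theorem inner_self_nonneg' (x : Sections B) : 0 ≤ evalUnit (Star.star x * x) :=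
  (inner_self_nonneg x).trans_eq (inner_eq x x)

theorem norm_inner_sq_le (x y : Sections B) :
    ‖inner x y‖ ^ 2 ≤ ‖inner x x‖ * ‖inner y y‖ := by
  have key : ∀ c : ℝ, 0 < c → ‖inner x x‖ ≤ c → ‖inner x y‖ ^ 2 ≤ c * ‖inner y y‖ := by
    intro c hc hxc
    set r := inner x y with hr
    have h := inner_self_nonneg' (x * unitHom r - (c : ℂ) • y)
    have h1 : Star.star (x * unitHom r - (c : ℂ) • y) * (x * unitHom r - (c : ℂ) • y) =
        unitHom (Star.star r) * (Star.star x * x * unitHom r)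
          - (c : ℂ) • (unitHom (Star.star r) * (Star.star x * y))
          - (c : ℂ) • (Star.star y * x * unitHom r) + (c : ℂ) • (c : ℂ) • (Star.star y * y) := by
      simp only [map_star, star_sub, StarMul.star_mul, StarModule.star_smul, _root_.sub_mul,
        _root_.mul_sub, smul_mul_assoc, mul_smul_comm, Complex.star_def, Complex.conj_ofReal,
        _root_.mul_assoc, smul_sub]
      abel
    rw [h1] at h
    simp only [evalUnit_add, evalUnit_sub, evalUnit_smul, evalUnit_unitHom_mul,
      evalUnit_mul_unitHom, ← inner_eq] at h
    rw [← star_inner x y, ← hr] at h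
    have h3 : Star.star r * (inner x x * r) ≤ c • (Star.star r * r) := by
      rw [← _root_.mul_assoc]
      refine (CStarAlgebra.star_left_conjugate_le_norm_smul (a := r)
        (hb := star_inner x x)).trans ?_
      exact smul_le_smul_of_nonneg_right hxc (star_mul_self_nonneg r)
    have h4 : c • (Star.star r * r) ≤ c • c • inner y y := by
      simp only [Complex.coe_smul] at h
      have h5 := h.trans (add_le_add_left (sub_le_sub_right (sub_le_sub_right h3 _) _) _)
      rw [sub_self, zero_sub, neg_add_eq_sub, sub_nonneg] at h5
      exact h5
    have h6 : Star.star r * r ≤ c • inner y y := (smul_le_smul_iff_of_pos_left hc).mp h4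
    calc ‖r‖ ^ 2 = ‖Star.star r * r‖ := by rw [CStarRing.norm_star_mul_self, sq]
      _ ≤ ‖c • inner y y‖ :=
        CStarAlgebra.norm_le_norm_of_nonneg_of_le (star_mul_self_nonneg r) h6
      _ = c * ‖inner y y‖ := by rw [norm_smul, Real.norm_of_nonneg hc.le]
  refine le_of_forall_pos_le_add fun ε hε => ?_
  have hq : 0 < ‖inner y y‖ + 1 := by positivity
  have h := key (‖inner x x‖ + ε / (‖inner y y‖ + 1)) (by positivity)
    (le_add_of_nonneg_right (by positivity))
  refine h.trans ?_
  rw [_root_.add_mul]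
  gcongr
  rw [div_mul_eq_mul_div, div_le_iff₀ hq]
  nlinarith

/-- Left multiplication by a positive element of the unit fibre, in quadratic form. -/
theorem norm_inner_unitHom_le (a : UnitFibre B) (ha : 0 ≤ a) (x : Sections B)
    (hx : 0 ≤ inner x (unitHom a * x)) :
    ‖inner x (unitHom a * x)‖ ≤ ‖a‖ * ‖inner x x‖ := by
  have hsa : IsSelfAdjoint (a : Unitization ℂ (UnitFibre B)) :=
    (IsSelfAdjoint.of_nonneg ha).inr ℂ
  have h1 := sub_nonneg.mpr hsa.le_algebraMap_norm_self
  obtain ⟨c, hc⟩ := CStarAlgebra.nonneg_iff_eq_star_mul_self.mp h1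
  have hfst : ((‖a‖ : ℝ) : ℂ) = Star.star c.fst * c.fst := by
    have h := congrArg (fun z : Unitization ℂ (UnitFibre B) => z.fst) hc
    simpa [Algebra.algebraMap_eq_smul_one, Unitization.norm_inr, sub_eq_add_neg] using h
  have hsnd : -a = Star.star c.fst • c.snd + c.fst • Star.star c.snd + Star.star c.snd * c.snd := by
    have h := congrArg (fun z : Unitization ℂ (UnitFibre B) => z.snd) hc
    simpa [Algebra.algebraMap_eq_smul_one, sub_eq_add_neg] using h
  have hz := inner_self_nonneg' (c.fst • x + unitHom c.snd * x)
  have h2 : Star.star (c.fst • x + unitHom c.snd * x) * (c.fst • x + unitHom c.snd * x) =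
      (Star.star c.fst * c.fst) • (Star.star x * x) + Star.star x * (unitHom
        (Star.star c.fst • c.snd + c.fst • Star.star c.snd + Star.star c.snd * c.snd) * x) := by
    simp only [map_add, map_smul, map_mul, map_star, star_add_section, StarMul.star_mul,
      StarModule.star_smul, _root_.add_mul, _root_.mul_add, smul_mul_assoc, mul_smul_comm,
      _root_.mul_assoc, SemigroupAction.mul_smul, smul_add]
    rw [smul_comm c.fst (Star.star c.fst) (Star.star x * x)]
    abel
  rw [h2, ← hfst, ← hsnd, map_neg, neg_mul, mul_neg, ← sub_eq_add_neg, evalUnit_sub,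
    evalUnit_smul, ← inner_eq, ← inner_eq, sub_nonneg, Complex.coe_smul] at hz
  calc ‖inner x (unitHom a * x)‖ ≤ ‖‖a‖ • inner x x‖ :=
        CStarAlgebra.norm_le_norm_of_nonneg_of_le hx hz
    _ = ‖a‖ * ‖inner x x‖ := by rw [norm_smul, norm_norm]

/-- Left multiplication by an element of a fibre is bounded for the `ℓ²`-norm. -/
theorem norm_inner_single_mul_le (g : G) (b : B g) (x : Sections B) :
    ‖inner (single g b * x) (single g b * x)‖ ≤ ‖b‖ ^ 2 * ‖inner x x‖ := by
  obtain ⟨d', hd⟩ := star_mul_self_pos rfl (inv_mul_cancel g) b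
  let d : UnitFibre B := d'
  let a : UnitFibre B := Star.star d * d
  have ha : Star.star (single g b) * single g b = unitHom a := by
    rw [star_single rfl, single_mul_single (inv_mul_cancel g), hd]
    rfl
  have hna : ‖a‖ = ‖b‖ ^ 2 := by
    have h := norm_star_mul_self rfl (inv_mul_cancel g) b
    rw [hd] at h
    exact h
  have hi : inner (single g b * x) (single g b * x) = inner x (unitHom a * x) := by
    rw [inner_eq, inner_eq, StarMul.star_mul, ← ha, _root_.mul_assoc, _root_.mul_assoc]
  rw [hi, ← hna]
  refine norm_inner_unitHom_le a (star_mul_self_nonneg (R := UnitFibre B) d) x ?_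
  rw [← hi]
  exact inner_self_nonneg _

end Order

/-- The norm `‖x‖ = ‖⟨x, x⟩‖ ^ (1/2)` of the Hilbert `B_e`-module `ℓ²(B)` on finitely supported
sections. -/
noncomputable def l2Norm (x : Sections B) : ℝ := √‖inner x x‖

theorem l2Norm_nonneg (x : Sections B) : 0 ≤ l2Norm x := Real.sqrt_nonneg _

theorem l2Norm_sq (x : Sections B) : l2Norm x ^ 2 = ‖inner x x‖ := Real.sq_sqrt (norm_nonneg _)

theorem norm_inner_le (x y : Sections B) : ‖inner x y‖ ≤ l2Norm x * l2Norm y := by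
  refine abs_le_of_sq_le_sq' ?_ (mul_nonneg (l2Norm_nonneg x) (l2Norm_nonneg y)) |>.2
  rw [mul_pow, l2Norm_sq, l2Norm_sq]
  exact norm_inner_sq_le x y

variable (B) in
/-- The norm of `ℓ²(B)` as a seminorm on the finitely supported sections. -/
noncomputable def l2Seminorm : Seminorm ℂ (Sections B) :=
  Seminorm.of l2Norm
    (fun x y => by
      refine abs_le_of_sq_le_sq' ?_ (add_nonneg (l2Norm_nonneg x) (l2Norm_nonneg y)) |>.2
      have h1 : ‖inner y x‖ ≤ l2Norm x * l2Norm y := by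
        rw [mul_comm]
        exact norm_inner_le y x
      have h2 := norm_inner_le x y
      calc l2Norm (x + y) ^ 2 = ‖(inner x x + inner x y) + (inner y x + inner y y)‖ := by
            rw [l2Norm_sq, inner_add_left, inner_add_right, inner_add_right]
        _ ≤ (‖inner x x‖ + ‖inner x y‖) + (‖inner y x‖ + ‖inner y y‖) :=
            (norm_add_le _ _).trans (add_le_add (norm_add_le _ _) (norm_add_le _ _))
        _ ≤ (l2Norm x ^ 2 + l2Norm x * l2Norm y) + (l2Norm x * l2Norm y + l2Norm y ^ 2) := by
            rw [l2Norm_sq, l2Norm_sq]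
            gcongr
        _ = (l2Norm x + l2Norm y) ^ 2 := by ring)
    (fun c x => by
      have h : inner (c • x) (c • x) = (Star.star c * c) • inner x x := by
        rw [inner_eq, inner_eq, StarModule.star_smul, smul_mul_assoc, mul_smul_comm, smul_smul,
          evalUnit_smul]
      rw [l2Norm, h, norm_smul, norm_mul, _root_.norm_star, Real.sqrt_mul (by positivity),
        Real.sqrt_mul_self (norm_nonneg c)]
      rfl)

variable (B) in
/-- The finitely supported sections, equipped with the norm of `ℓ²(B)`. -/
def PreL2 : Type _ := Sections B

noncomputable instance : AddCommGroup (PreL2 B) := inferInstanceAs (AddCommGroup (Sections B))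
noncomputable instance : Module ℂ (PreL2 B) := inferInstanceAs (Module ℂ (Sections B))
noncomputable instance : SeminormedAddCommGroup (PreL2 B) :=
  fast_instance% (l2Seminorm B).toAddGroupSeminorm.toSeminormedAddCommGroup
noncomputable instance : NormedSpace ℂ (PreL2 B) where
  norm_smul_le c x := (map_smul_eq_mul (l2Seminorm B) c x).le

variable (B) in
/-- The Hilbert `B_e`-module `ℓ²(B)`: the completion of the finitely supported sections in the norm
given by the inner product `⟨x, y⟩ = ∑ g, (x g)* (y g)`. -/
abbrev L2 : Type _ := UniformSpace.Completion (PreL2 B)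

theorem exists_l2Norm_mul_le (f : Sections B) :
    ∃ C : ℝ, ∀ x : Sections B, l2Norm (f * x) ≤ C * l2Norm x := by
  induction f using Sections.induction with
  | zero => exact ⟨0, fun x => by
      rw [zero_mul, zero_mul]
      exact (map_zero (l2Seminorm B)).le⟩
  | add f f' h h' =>
    obtain ⟨C, hC⟩ := h
    obtain ⟨C', hC'⟩ := h'
    refine ⟨C + C', fun x => ?_⟩
    rw [_root_.add_mul, _root_.add_mul]
    exact (map_add_le_add (l2Seminorm B) _ _).trans (add_le_add (hC x) (hC' x))
  | single g b =>
    refine ⟨‖b‖, fun x => ?_⟩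
    refine abs_le_of_sq_le_sq' ?_ (mul_nonneg (norm_nonneg b) (l2Norm_nonneg x)) |>.2
    rw [mul_pow, l2Norm_sq, l2Norm_sq]
    exact norm_inner_single_mul_le g b x

/-- Left multiplication (convolution) by a finitely supported section, as a bounded operator for
the norm of `ℓ²(B)`. -/
noncomputable def leftMul (f : Sections B) : PreL2 B →L[ℂ] PreL2 B :=
  LinearMap.mkContinuousOfExistsBound (sectionMul f : Sections B →ₗ[ℂ] Sections B)
    (exists_l2Norm_mul_le f)

/-- The regular representation `λ` of finitely supported sections by bounded operators on `ℓ²(B)`: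
`λ(f) x = f * x` for all finitely supported `x`. -/
noncomputable def leftRep (f : Sections B) : L2 B →L[ℂ] L2 B := (leftMul f).completion

/-- The inclusion of the finitely supported sections into `ℓ²(B)`. -/
noncomputable def toL2 (x : Sections B) : L2 B :=
  UniformSpace.Completion.coe' (α := PreL2 B) x

theorem norm_toL2 (x : Sections B) : ‖toL2 x‖ = l2Norm x :=
  UniformSpace.Completion.norm_coe (E := PreL2 B) x

theorem denseRange_toL2 : DenseRange (toL2 : Sections B → L2 B) :=
  UniformSpace.Completion.denseRange_coe (α := PreL2 B)

theorem toL2_add (x y : Sections B) : toL2 (x + y) = toL2 x + toL2 y :=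
  UniformSpace.Completion.coe_add (α := PreL2 B) x y

theorem toL2_smul (c : ℂ) (x : Sections B) : toL2 (c • x) = c • toL2 x :=
  UniformSpace.Completion.coe_smul (X := PreL2 B) c x

theorem leftRep_toL2 (f x : Sections B) : leftRep f (toL2 x) = toL2 (f * x) :=
  ContinuousLinearMap.completion_apply_coe (leftMul f) x

theorem leftRep_ext {S T : L2 B →L[ℂ] L2 B} (h : ∀ x : Sections B, S (toL2 x) = T (toL2 x)) :
    S = T := by
  ext y
  exact denseRange_toL2.induction_on y (isClosed_eq S.continuous T.continuous) h

theorem leftRep_add (f f' : Sections B) : leftRep (f + f') = leftRep f + leftRep f' := by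
  refine leftRep_ext fun x => ?_
  rw [_root_.add_apply, leftRep_toL2, leftRep_toL2, leftRep_toL2, ← toL2_add,
    _root_.add_mul]

theorem leftRep_smul (c : ℂ) (f : Sections B) : leftRep (c • f) = c • leftRep f := by
  refine leftRep_ext fun x => ?_
  rw [_root_.smul_apply, leftRep_toL2, leftRep_toL2, ← toL2_smul, smul_mul_assoc]

theorem leftRep_mul (f f' : Sections B) : leftRep (f * f') = (leftRep f).comp (leftRep f') := by
  refine leftRep_ext fun x => ?_
  rw [ContinuousLinearMap.comp_apply, leftRep_toL2, leftRep_toL2, leftRep_toL2, _root_.mul_assoc]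

/-- The operators `λ(f)` are adjointable on finitely supported sections, with `λ(f)* = λ(f*)`. -/
theorem inner_mul_left (f x y : Sections B) : inner (f * x) y = inner x (Star.star f * y) := by
  rw [inner_eq, inner_eq, StarMul.star_mul, _root_.mul_assoc]

theorem sq_norm_leftRep_le (f : Sections B) : ‖leftRep f‖ ^ 2 ≤ ‖leftRep (Star.star f * f)‖ := by
  have h : ∀ y : L2 B, ‖leftRep f y‖ ^ 2 ≤ ‖leftRep (Star.star f * f)‖ * ‖y‖ ^ 2 := by
    intro y
    refine denseRange_toL2.induction_on y (isClosed_le (by fun_prop) (by fun_prop)) fun x => ?_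
    calc ‖leftRep f (toL2 x)‖ ^ 2 = ‖inner x (Star.star f * (f * x))‖ := by
          rw [leftRep_toL2, norm_toL2, l2Norm_sq, inner_mul_left]
      _ ≤ ‖toL2 x‖ * ‖leftRep (Star.star f * f) (toL2 x)‖ := by
          rw [leftRep_toL2, norm_toL2, norm_toL2, _root_.mul_assoc]
          exact norm_inner_le _ _
      _ ≤ ‖toL2 x‖ * (‖leftRep (Star.star f * f)‖ * ‖toL2 x‖) := by
          gcongr
          exact ContinuousLinearMap.le_opNorm _ _
      _ = ‖leftRep (Star.star f * f)‖ * ‖toL2 x‖ ^ 2 := by ring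
  have h' : ‖leftRep f‖ ≤ √‖leftRep (Star.star f * f)‖ := by
    refine ContinuousLinearMap.opNorm_le_bound _ (Real.sqrt_nonneg _) fun y => ?_
    refine abs_le_of_sq_le_sq' ?_ (by positivity) |>.2
    rw [mul_pow, Real.sq_sqrt (norm_nonneg _)]
    exact h y
  calc ‖leftRep f‖ ^ 2 ≤ √‖leftRep (Star.star f * f)‖ ^ 2 := by gcongr
    _ = ‖leftRep (Star.star f * f)‖ := Real.sq_sqrt (norm_nonneg _)

theorem norm_leftRep_mul_le (f f' : Sections B) :
    ‖leftRep (f * f')‖ ≤ ‖leftRep f‖ * ‖leftRep f'‖ := by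
  rw [leftRep_mul]
  exact ContinuousLinearMap.opNorm_comp_le _ _

theorem norm_leftRep_le_star (f : Sections B) : ‖leftRep f‖ ≤ ‖leftRep (Star.star f)‖ := by
  have h := (sq_norm_leftRep_le f).trans (norm_leftRep_mul_le (Star.star f) f)
  rcases (norm_nonneg (leftRep f)).eq_or_lt with h0 | h0
  · rw [← h0]
    exact norm_nonneg _
  · rw [sq] at h
    exact le_of_mul_le_mul_right h h0

theorem norm_leftRep_star (f : Sections B) : ‖leftRep (Star.star f)‖ = ‖leftRep f‖ := by
  refine le_antisymm ?_ (norm_leftRep_le_star f)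
  simpa only [_root_.star_star] using norm_leftRep_le_star (Star.star f)

variable (B) in
/-- The reduced C*-seminorm `f ↦ ‖λ(f)‖`, the norm being that of operators on `ℓ²(B)`. -/
noncomputable def reducedSeminorm : CStarSeminorm (Sections B) where
  toSeminorm := Seminorm.of (fun f => ‖leftRep f‖)
    (fun f f' => by
      rw [leftRep_add]
      exact norm_add_le _ _)
    (fun c f => by rw [leftRep_smul, norm_smul])
  mul_le' := norm_leftRep_mul_le
  star' := norm_leftRep_star
  star_mul_self' f := by
    refine le_antisymm ?_ (sq_norm_leftRep_le f)
    refine (norm_leftRep_mul_le (Star.star f) f).trans_eq ?_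
    rw [norm_leftRep_star, ← sq]
    rfl

theorem reducedSeminorm_apply (f : Sections B) : reducedSeminorm B f = ‖leftRep f‖ := rfl

/-- The restriction of a C*-seminorm along the inclusion of the unit fibre. -/
noncomputable def restrictUnit (p : CStarSeminorm (Sections B)) :
    CStarSeminorm (UnitFibre B) where
  toSeminorm := Seminorm.of (fun a => p (unitHom a))
    (fun a b => by
      rw [map_add]
      exact map_add_le_add p.toSeminorm _ _)
    (fun c a => by
      rw [map_smul]
      exact map_smul_eq_mul p.toSeminorm _ _)
  mul_le' a b := (congrArg p (map_mul unitHom a b)).trans_le (p.mul_le _ _)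
  star' a := (congrArg p (map_star unitHom a)).trans (p.star_eq _)
  star_mul_self' a := by
    refine Eq.trans (congrArg p ?_) (p.star_mul_self (unitHom a))
    rw [map_mul, map_star]

/-- Every C*-seminorm on the sections is bounded on each fibre by the norm of the fibre. -/
theorem seminorm_single_le (p : CStarSeminorm (Sections B)) (g : G) (a : B g) :
    p (single g a) ≤ ‖a‖ := by
  refine abs_le_of_sq_le_sq' ?_ (norm_nonneg a) |>.2
  rw [← p.star_mul_self, star_single rfl, single_mul_single (inv_mul_cancel g),
    ← norm_star_mul_self rfl (inv_mul_cancel g) a]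
  exact (restrictUnit p).le_norm (A := UnitFibre B) _

theorem exists_seminorm_le (f : Sections B) :
    ∃ C : ℝ, ∀ p : CStarSeminorm (Sections B), p f ≤ C := by
  induction f using Sections.induction with
  | zero => exact ⟨0, fun p => (map_zero p.toSeminorm).le⟩
  | add f f' h h' =>
    obtain ⟨C, hC⟩ := h
    obtain ⟨C', hC'⟩ := h'
    exact ⟨C + C', fun p => (map_add_le_add p.toSeminorm f f').trans (add_le_add (hC p) (hC' p))⟩
  | single g a => exact ⟨‖a‖, fun p => seminorm_single_le p g a⟩

theorem bddAbove_seminorm (f : Sections B) :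
    BddAbove (Set.range fun p : CStarSeminorm (Sections B) => p f) := by
  obtain ⟨C, hC⟩ := exists_seminorm_le f
  exact ⟨C, by rintro _ ⟨p, rfl⟩; exact hC p⟩

instance : Nonempty (CStarSeminorm (Sections B)) := ⟨reducedSeminorm B⟩

theorem seminorm_nonneg (p : CStarSeminorm (Sections B)) (f : Sections B) : 0 ≤ p f :=
  apply_nonneg p.toSeminorm f

theorem iSup_seminorm_nonneg (f : Sections B) :
    0 ≤ ⨆ p : CStarSeminorm (Sections B), p f :=
  Real.iSup_nonneg fun p => seminorm_nonneg p f

variable (B) in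
/-- The largest C*-seminorm on the finitely supported sections of a Fell bundle. -/
noncomputable def maxSeminorm : CStarSeminorm (Sections B) where
  toSeminorm := Seminorm.of (fun f => ⨆ p : CStarSeminorm (Sections B), p f)
    (fun f f' => ciSup_le fun p => (map_add_le_add p.toSeminorm f f').trans
      (add_le_add (le_ciSup (bddAbove_seminorm f) p) (le_ciSup (bddAbove_seminorm f') p)))
    (fun c f => by
      rw [Real.mul_iSup_of_nonneg (norm_nonneg c)]
      exact iSup_congr fun p => map_smul_eq_mul p.toSeminorm c f)
  mul_le' f f' := ciSup_le fun p => (p.mul_le f f').trans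
    (mul_le_mul (le_ciSup (bddAbove_seminorm f) p) (le_ciSup (bddAbove_seminorm f') p)
      (seminorm_nonneg p f') (iSup_seminorm_nonneg f))
  star' f := iSup_congr fun p => p.star_eq f
  star_mul_self' f := by
    refine le_antisymm (ciSup_le fun p => ?_) ?_
    · rw [p.star_mul_self]
      exact pow_le_pow_left₀ (seminorm_nonneg p f) (le_ciSup (bddAbove_seminorm f) p) 2
    · have h : ⨆ p : CStarSeminorm (Sections B), p f ≤
          √(⨆ p : CStarSeminorm (Sections B), p (Star.star f * f)) := by
        refine ciSup_le fun p => Real.le_sqrt_of_sq_le ?_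
        rw [← p.star_mul_self]
        exact le_ciSup (bddAbove_seminorm (Star.star f * f)) p
      refine (pow_le_pow_left₀ (iSup_seminorm_nonneg f) h 2).trans_eq ?_
      exact Real.sq_sqrt (iSup_seminorm_nonneg _)

theorem le_maxSeminorm (p : CStarSeminorm (Sections B)) (f : Sections B) :
    p f ≤ maxSeminorm B f := le_ciSup (bddAbove_seminorm f) p

variable (B) in
/-- The (full) cross-sectional C*-algebra `C*(B)`: the completion of the *-algebra of finitely
supported sections in its largest C*-seminorm. -/
abbrev CrossSectional : Type _ := (maxSeminorm B).Completion

/-- The canonical *-homomorphism from the finitely supported sections to `C*(B)`. -/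
noncomputable def toCrossSectional : Sections B →⋆ₙₐ[ℂ] CrossSectional B := (maxSeminorm B).ι

variable (B) in
/-- The reduced cross-sectional C*-algebra `C*_r(B)`: the completion of the *-algebra of finitely
supported sections in the norm `f ↦ ‖λ(f)‖` of operators on `ℓ²(B)`, that is, the closure of the
image of `λ`. -/
abbrev ReducedCrossSectional : Type _ := (reducedSeminorm B).Completion

/-- The canonical *-homomorphism from the finitely supported sections to `C*_r(B)`. -/
noncomputable def toReduced : Sections B →⋆ₙₐ[ℂ] ReducedCrossSectional B := (reducedSeminorm B).ι

variable (B) in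
/-- The regular representation `Λ : C*(B) → C*_r(B)`. -/
noncomputable def regularRep : CrossSectional B →⋆ₙₐ[ℂ] ReducedCrossSectional B :=
  CStarSeminorm.map (le_maxSeminorm (reducedSeminorm B))

theorem regularRep_toCrossSectional (f : Sections B) :
    regularRep B (toCrossSectional f) = toReduced f :=
  CStarSeminorm.map_ι (le_maxSeminorm (reducedSeminorm B)) f

theorem norm_toReduced (f : Sections B) : ‖toReduced f‖ = ‖leftRep f‖ :=
  (reducedSeminorm B).norm_ι f

end Algebra

end FellBundle

/-! ### Positivity, hereditary subalgebras and aperiodicity -/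

/-- Positive elements of a C*-algebra. -/
def IsPositiveElement {A : Type*} [NonUnitalCStarAlgebra A] (a : A) : Prop :=
  ∃ b : A, a = star b * b

/-- Hereditary C*-subalgebras of a C*-algebra: the closed *-subalgebras `D` such that
`0 ≤ b ≤ a` and `a ∈ D` imply `b ∈ D`. -/
structure IsHereditarySubalgebra {A : Type*} [NonUnitalCStarAlgebra A]
    (D : NonUnitalStarSubalgebra ℂ A) : Prop where
  isClosed : IsClosed (D : Set A)
  mem_of_le : ∀ a b : A, a ∈ D → IsPositiveElement b → IsPositiveElement (a - b) → b ∈ D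

namespace FellBundle

/-- The product `d b d` in `B t`, for `d` in the unit fibre and `b` in `B t`. -/
def conj {G : Type*} [Group G] {B : G → Type*} [∀ g, NormedAddCommGroup (B g)]
    [∀ g, NormedSpace ℂ (B g)] [FellBundle B] {t : G} (d : UnitFibre B) (b : B t) : B t :=
  mul (mul_one t) (mul (one_mul t) (d : B 1) b) (d : B 1)

/-- A Fell bundle is aperiodic if `inf {‖d b d‖ : d ∈ D, d ≥ 0, ‖d‖ = 1} = 0` for every `t ≠ e`,
every `b ∈ B t` and every non-zero hereditary C*-subalgebra `D` of `B_e`. -/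
def IsAperiodic {G : Type*} [Group G] (B : G → Type*) [∀ g, NormedAddCommGroup (B g)]
    [∀ g, NormedSpace ℂ (B g)] [FellBundle B] : Prop :=
  ∀ t : G, t ≠ 1 → ∀ b : B t, ∀ D : NonUnitalStarSubalgebra ℂ (UnitFibre B),
    IsHereditarySubalgebra D → (∃ d ∈ D, d ≠ 0) →
      IsGLB {r : ℝ | ∃ d ∈ D, IsPositiveElement d ∧ ‖d‖ = 1 ∧ r = ‖conj d b‖} 0

end FellBundle

/-!
Write `E f = f 1` for the coefficient of a section at the unit element. It satisfies
`‖E f‖ ≤ ‖λ(f)‖` (`FellBundle.norm_evalUnit_le_norm_leftRep`), and `E (h* h) = ⟨h, h⟩`, so that `E`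
determines the norm of `ℓ²(B)`.

For the equivalence: if `ker Ψ ⊆ ker Λ`, then `‖Λ(a)‖ ≤ ‖Ψ(a)‖` for all `a`
(`norm_apply_le_of_ker_le`), which bounds `‖E f‖` by `‖Ψ(f)‖`. Conversely, if
`‖E (h* h)‖ ≤ ‖Ψ(h* h)‖` for all sections `h`, then `‖h‖₂ ≤ ‖Ψ(h)‖`. When sections `f` converge to
`a ∈ ker Ψ`, the images `Ψ(f x)` converge to `0` for every section `x`, hence so do the vectors `f x`
of `ℓ²(B)`, and `Λ(a) = 0` (`FellBundle.regularRep_eq_zero_of_norm_evalUnit_le`).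

For aperiodic bundles it remains to prove `‖E f‖ ≤ ‖Ψ(f)‖` for `f = h* h`. Given `s < ‖E f‖`, one
looks for `x` in the unit fibre with `‖x (E f) x‖ ≥ s ‖x‖²` such that `x f x` is close to
`x (E f) x`; as `Ψ` is isometric on the unit fibre, this gives `‖Ψ(f)‖ ≥ s` up to a small error. The
hereditary subalgebras used are those of the form `{x | x e = x = e x}` with `e` self-adjoint
(`supportSubalgebra`). The first `e` is an approximate spectral projection of `E f` for the interval
`[s, ‖E f‖]`. For each of the finitely many other coefficients `b` of `f`, aperiodicity provides a
positive `d` of norm one in the current subalgebra with `d b d` small; an approximate spectral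
projection of `d` for `[1/2, 1]` is divisible by `d` on both sides, so its support subalgebra is
contained in the current one and compresses `b` uniformly to something small
(`FellBundle.IsAperiodic.exists_supportSubalgebra_le`).
-/

/-! ### C*-algebraic preliminaries -/

/-- A *-homomorphism of C*-algebras vanishing on the kernel of another one is dominated by it in
norm. -/
theorem norm_apply_le_of_ker_le {A D E : Type*} [NonUnitalCStarAlgebra A]
    [NonUnitalCStarAlgebra D] [NonUnitalCStarAlgebra E] (φ : A →⋆ₙₐ[ℂ] D) (ψ : A →⋆ₙₐ[ℂ] E)
    (h : ∀ a, φ a = 0 → ψ a = 0) (a : A) : ‖ψ a‖ ≤ ‖φ a‖ := by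
  -- It suffices to treat self-adjoint elements; there the excess of the spectrum over `‖φ x‖` is
  -- cut out by the function `F`, which kills `φ x` and hence `ψ x`.
  have key : ∀ x : A, IsSelfAdjoint x → ‖ψ x‖ ≤ ‖φ x‖ := by
    intro x hx
    have hφx : IsSelfAdjoint (φ x) := hx.map φ
    have hψx : IsSelfAdjoint (ψ x) := hx.map ψ
    have hφc : Continuous φ :=
      AddMonoidHomClass.continuous_of_bound φ 1 fun z => by
        simpa using NonUnitalStarAlgHom.norm_apply_le φ z
    have hψc : Continuous ψ :=
      AddMonoidHomClass.continuous_of_bound ψ 1 fun z => by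
        simpa using NonUnitalStarAlgHom.norm_apply_le ψ z
    set c := ‖φ x‖ with hc
    have hc0 : 0 ≤ c := norm_nonneg _
    let F : ℝ → ℝ := fun t => max 0 (|t| - c)
    have hF : Continuous F := by fun_prop
    have hF0 : F 0 = 0 := by simp [F, hc0]
    have h1 : φ (cfcₙ F x) = 0 := by
      rw [NonUnitalStarAlgHom.map_cfcₙ φ F x hF.continuousOn hF0 hφc hx hφx,
        ← cfcₙ_const_zero ℝ (φ x)]
      refine cfcₙ_congr fun t ht => ?_
      have := NonUnitalIsometricContinuousFunctionalCalculus.norm_quasispectrum_le (φ x) ht hφx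
      rw [Real.norm_eq_abs] at this
      exact max_eq_left (by linarith)
    have h2 := h _ h1
    rw [NonUnitalStarAlgHom.map_cfcₙ ψ F x hF.continuousOn hF0 hψc hx hψx,
      ← cfcₙ_const_zero ℝ (ψ x)] at h2
    have h3 := eqOn_of_cfcₙ_eq_cfcₙ h2 hψx hF.continuousOn hF0
    conv_lhs => rw [← cfcₙ_id ℝ (ψ x)]
    refine norm_cfcₙ_le fun t ht => ?_
    have h4 : max 0 (|t| - c) = 0 := h3 ht
    have h5 := le_max_right 0 (|t| - c)
    rw [id, Real.norm_eq_abs]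
    linarith
  refine le_of_sq_le_sq ?_ (norm_nonneg _)
  have := key _ (IsSelfAdjoint.star_mul_self a)
  rwa [map_mul, map_mul, map_star, map_star, CStarRing.norm_star_mul_self,
    CStarRing.norm_star_mul_self, ← sq, ← sq] at this

section Support

variable {A : Type*} [NonUnitalCStarAlgebra A]

/-- The *-subalgebra of the elements for which the self-adjoint element `e` is a two-sided unit. -/
def supportSubalgebra (e : A) (he : IsSelfAdjoint e) : NonUnitalStarSubalgebra ℂ A where
  carrier := {x | x * e = x ∧ e * x = x}
  add_mem' := fun hx hy => ⟨by rw [add_mul, hx.1, hy.1], by rw [mul_add, hx.2, hy.2]⟩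
  zero_mem' := ⟨zero_mul e, mul_zero e⟩
  mul_mem' := fun hx hy => ⟨by rw [mul_assoc, hy.1], by rw [← mul_assoc, hx.2]⟩
  smul_mem' := fun c x hx => ⟨by rw [smul_mul_assoc, hx.1], by rw [mul_smul_comm, hx.2]⟩
  star_mem' := fun {x} hx => ⟨by
      nth_rewrite 1 [← he.star_eq]
      rw [← star_mul, hx.2], by
      nth_rewrite 1 [← he.star_eq]
      rw [← star_mul, hx.1]⟩

theorem mem_supportSubalgebra {e : A} {he : IsSelfAdjoint e} {x : A} :
    x ∈ supportSubalgebra e he ↔ x * e = x ∧ e * x = x := Iff.rfl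

attribute [local instance] CStarAlgebra.spectralOrder CStarAlgebra.spectralOrderedRing

theorem IsPositiveElement.nonneg {a : A} (ha : IsPositiveElement a) : 0 ≤ a := by
  obtain ⟨b, rfl⟩ := ha
  exact star_mul_self_nonneg b

theorem isHereditarySubalgebra_supportSubalgebra (e : A) (he : IsSelfAdjoint e) :
    IsHereditarySubalgebra (supportSubalgebra e he) where
  isClosed := (isClosed_eq (by fun_prop) continuous_id).inter
    (isClosed_eq (by fun_prop) continuous_id)
  mem_of_le := by
    rintro a b ⟨ha1, ha2⟩ ⟨c, hc⟩ ⟨d, hd⟩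
    -- Compressing `c* c + d* d = a` by `1 - e` gives `0`, so `c` and `d` vanish on `1 - e`.
    have hsum : star (c - c * e) * (c - c * e) + star (d - d * e) * (d - d * e) = 0 := by
      have h1 : ∀ z : A, star (z - z * e) * (z - z * e) =
          star z * z - (star z * z) * e - e * (star z * z) + e * (star z * z) * e := by
        intro z
        rw [star_sub, star_mul, he.star_eq]
        noncomm_ring
      rw [h1, h1, ← hc, ← hd, sub_mul, mul_sub, sub_mul, ha1, ha2, ha1]
      abel
    have h0 : star (c - c * e) * (c - c * e) = 0 := by
      refine le_antisymm ?_ (star_mul_self_nonneg _)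
      rw [eq_neg_of_add_eq_zero_left hsum]
      exact neg_nonpos.mpr (star_mul_self_nonneg _)
    have hce : c * e = c := (sub_eq_zero.mp (CStarRing.star_mul_self_eq_zero_iff _ |>.mp h0)).symm
    have hec : e * star c = star c := by
      nth_rewrite 1 [← he.star_eq]
      rw [← star_mul, hce]
    rw [mem_supportSubalgebra, hc]
    exact ⟨by rw [mul_assoc, hce], by rw [← mul_assoc, hec]⟩

/-- For `a ≥ 0` and `0 < s < ‖a‖`, functional calculus gives an approximate spectral projection `e`
of `a` for the interval `[s, ‖a‖]`: it is divisible by `a`, it is dominated by `s⁻¹ a`, and it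
is a unit for a non-zero element. -/
theorem exists_spectral_cutoff {a : A} (ha : 0 ≤ a) {s : ℝ} (hs : 0 < s) (hsa : s < ‖a‖) :
    ∃ e h k : A, IsSelfAdjoint e ∧ e = h * a ∧ e = a * h ∧ ‖h‖ ≤ s⁻¹ ∧ k ≠ 0 ∧ k * e = k ∧
      e * k = k ∧ e * e ≤ s⁻¹ • a := by
  have hsa' : IsSelfAdjoint a := .of_nonneg ha
  obtain ⟨m, hsm, hma⟩ := exists_between hsa
  have hms : 0 < m - s := sub_pos.mpr hsm
  have hm0 : 0 < m := hs.trans hsm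
  let p : ℝ → ℝ := fun t => max 0 (min 1 ((t - s) / (m - s)))
  let η : ℝ → ℝ := fun t => p t / max t s
  let q : ℝ → ℝ := fun t => max 0 (t - m)
  have hpos : ∀ t : ℝ, 0 < max t s := fun t => lt_max_of_lt_right hs
  have hp : Continuous p := by fun_prop
  have hη : Continuous η := hp.div (by fun_prop) fun t => (hpos t).ne'
  have hq : Continuous q := by fun_prop
  have plow : ∀ t, t ≤ s → p t = 0 := fun t ht => max_eq_left
    ((min_le_right _ _).trans (div_nonpos_of_nonpos_of_nonneg (by linarith) hms.le))
  have phigh : ∀ t, m ≤ t → p t = 1 := fun t ht => by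
    have : 1 ≤ (t - s) / (m - s) := by rw [le_div_iff₀ hms]; linarith
    simp [p, this]
  have p_nonneg : ∀ t, 0 ≤ p t := fun t => le_max_left _ _
  have p_le : ∀ t, p t ≤ 1 := fun t => max_le zero_le_one (min_le_left _ _)
  have hp0 : p 0 = 0 := plow 0 hs.le
  have hη0 : η 0 = 0 := by simp [η, hp0]
  have hq0 : q 0 = 0 := by simp [q, hm0.le]
  have hηp : ∀ t, η t * t = p t := fun t => by
    rcases le_total t s with ht | ht
    · simp [η, plow t ht]
    · simp only [η, max_eq_left ht]
      exact div_mul_cancel₀ _ (hs.trans_le ht).ne'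
  have hqp : ∀ t, q t * p t = q t := fun t => by
    rcases le_total t m with ht | ht
    · have : q t = 0 := max_eq_left (by linarith)
      rw [this, zero_mul]
    · rw [phigh t ht, mul_one]
  have hid : cfcₙ (fun t : ℝ => t) a = a := cfcₙ_id' ℝ a
  refine ⟨cfcₙ p a, cfcₙ η a, cfcₙ q a, cfcₙ_predicate p a, ?_, ?_, ?_, ?_, ?_, ?_, ?_⟩
  · nth_rewrite 3 [← hid]
    rw [← cfcₙ_mul η (fun t => t) a hη.continuousOn hη0 continuousOn_id rfl]
    simp only [hηp]
  · nth_rewrite 2 [← hid]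
    rw [← cfcₙ_mul (fun t => t) η a continuousOn_id rfl hη.continuousOn hη0]
    simp only [mul_comm _ (η _), hηp]
  · refine norm_cfcₙ_le fun t _ => ?_
    rw [Real.norm_of_nonneg (div_nonneg (p_nonneg t) (hpos t).le), ← one_div]
    exact div_le_div₀ zero_le_one (p_le t) hs (le_max_right _ _)
  · intro h0
    rw [← cfcₙ_const_zero ℝ a] at h0
    have h1 := eqOn_of_cfcₙ_eq_cfcₙ h0 hsa' hq.continuousOn hq0
    -- If `q` vanished on the spectrum, the spectrum would lie in `[0, m]`, and `‖a‖ ≤ m`.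
    refine hma.not_ge ?_
    conv_lhs => rw [← hid]
    refine norm_cfcₙ_le fun t ht => ?_
    have h2 : max 0 (t - m) = 0 := h1 ht
    have h3 := le_max_right 0 (t - m)
    rw [Real.norm_of_nonneg (quasispectrum_nonneg_of_nonneg a ha t ht)]
    linarith
  · rw [← cfcₙ_mul q p a hq.continuousOn hq0 hp.continuousOn hp0]
    simp only [hqp]
  · rw [← cfcₙ_mul p q a hp.continuousOn hp0 hq.continuousOn hq0]
    simp only [mul_comm (p _), hqp]
  · nth_rewrite 3 [← hid]
    rw [← cfcₙ_mul p p a hp.continuousOn hp0 hp.continuousOn hp0, ← cfcₙ_smul s⁻¹ (fun t => t) a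
      continuousOn_id rfl]
    refine cfcₙ_mono (fun t ht => ?_) (by fun_prop) (by fun_prop) (by simp [hp0]) (by simp)
    have ht0 := quasispectrum_nonneg_of_nonneg a ha t ht
    rcases le_total t s with hts | hts
    · simp only [plow t hts, smul_eq_mul, mul_zero]
      exact mul_nonneg (inv_nonneg.mpr hs.le) ht0
    · rw [smul_eq_mul, inv_mul_eq_div]
      exact (mul_le_one₀ (p_le t) (p_nonneg t) (p_le t)).trans ((one_le_div hs).mpr hts)

/-- An element supported where `a ≥ s` sees `a` as at least `s`. -/
theorem norm_sq_le_of_mul_self_le {a e x : A} {s : ℝ} (hs : 0 < s)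
    (hea : e * e ≤ s⁻¹ • a) (hx : e * x = x) : s * ‖x‖ ^ 2 ≤ ‖star x * a * x‖ := by
  have h1 : star x * x ≤ s⁻¹ • (star x * a * x) := by
    have h := star_left_conjugate_le_conjugate hea x
    have h2 : star x * (e * e) * x = star x * x := by
      rw [mul_assoc, mul_assoc, hx, hx]
    rwa [h2, mul_smul_comm, smul_mul_assoc] at h
  have h2 := CStarAlgebra.norm_le_norm_of_nonneg_of_le (star_mul_self_nonneg x) h1
  rw [CStarRing.norm_star_mul_self, ← sq, norm_smul, Real.norm_of_nonneg (by positivity),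
    inv_mul_eq_div, le_div_iff₀ hs] at h2
  linarith

end Support

namespace FellBundle

variable {G : Type*} [Group G] {B : G → Type*} [∀ g, NormedAddCommGroup (B g)]
  [∀ g, NormedSpace ℂ (B g)] [FellBundle B]

/-! ### The coefficient at the unit element and the regular representation -/

theorem l2Norm_unitHom (a : UnitFibre B) : l2Norm (unitHom a) = ‖a‖ := by
  rw [l2Norm, inner_eq, evalUnit_mul_unitHom, ← map_star]
  have h : evalUnit (unitHom (Star.star a)) = Star.star a := single_apply_self (B := B) 1 _
  rw [h, CStarRing.norm_star_mul_self, Real.sqrt_mul_self (norm_nonneg a)]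

theorem norm_evalUnit_le_norm_leftRep (f : Sections B) : ‖evalUnit f‖ ≤ ‖leftRep f‖ := by
  set a := evalUnit f with ha
  rcases eq_or_ne a 0 with h0 | h0
  · rw [h0, norm_zero]
    exact norm_nonneg _
  have hpos : 0 < ‖a‖ := norm_pos_iff.mpr h0
  -- Test `λ(f)` on the vector `a*` against the vector `a a*`.
  have h := norm_inner_le (unitHom (a * Star.star a)) (f * unitHom (Star.star a))
  rw [inner_eq, ← map_star, evalUnit_unitHom_mul, evalUnit_mul_unitHom, ← ha,
    CStarRing.norm_star_mul_self, l2Norm_unitHom, CStarRing.norm_self_mul_star, ← norm_toL2,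
    ← leftRep_toL2] at h
  have h1 := (leftRep f).le_opNorm (toL2 (unitHom (Star.star a)))
  rw [norm_toL2, l2Norm_unitHom, _root_.norm_star] at h1
  have h2 := h.trans (mul_le_mul_of_nonneg_left h1 (by positivity))
  have h3 : ‖a‖ * (‖a‖ * ‖a‖ * ‖a‖) ≤ ‖leftRep f‖ * (‖a‖ * ‖a‖ * ‖a‖) := by linarith
  exact le_of_mul_le_mul_right h3 (by positivity)

theorem norm_toCrossSectional (f : Sections B) : ‖toCrossSectional f‖ = maxSeminorm B f :=
  (maxSeminorm B).norm_ι f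

theorem norm_leftRep_le (f : Sections B) : ‖leftRep f‖ ≤ ‖toCrossSectional f‖ :=
  (le_maxSeminorm (reducedSeminorm B) f).trans_eq (norm_toCrossSectional f).symm

section Representation

variable {D : Type*} [NonUnitalCStarAlgebra D] (Ψ : CrossSectional B →⋆ₙₐ[ℂ] D)

/-- If the coefficient at the unit element of every `h* h` is controlled by `Ψ`, then the vectors
`a x ∈ ℓ²(B)`, for `a ∈ C*(B)` and a finitely supported section `x`, are controlled by `Ψ(a x)`; so
`Λ(a)` vanishes if `Ψ(a)` does. -/
theorem regularRep_eq_zero_of_norm_evalUnit_le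
    (hE : ∀ h : Sections B, ‖evalUnit (Star.star h * h)‖ ≤
      ‖Ψ (toCrossSectional (Star.star h * h))‖)
    {a : CrossSectional B} (ha : Ψ a = 0) : regularRep B a = 0 := by
  have hl2 : ∀ h : Sections B, l2Norm h ≤ ‖Ψ (toCrossSectional h)‖ := fun h => by
    refine le_of_sq_le_sq ?_ (norm_nonneg _)
    have := hE h
    rwa [← inner_eq, ← l2Norm_sq, map_mul, map_mul, map_star, map_star,
      CStarRing.norm_star_mul_self, ← sq] at this
  have happrox : ∀ ε : ℝ, 0 < ε → ∃ f : Sections B, ‖a - toCrossSectional f‖ < ε := fun ε hε => by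
    obtain ⟨f, hf⟩ := (maxSeminorm B).denseRange_ι.exists_dist_lt a hε
    exact ⟨f, by rwa [dist_eq_norm] at hf⟩
  have hbound : ∀ ε : ℝ, 0 < ε → ∀ f : Sections B, ‖a - toCrossSectional f‖ < ε →
      ‖leftRep f‖ ≤ 2 * ε := by
    intro ε hε f hf
    refine ContinuousLinearMap.opNorm_le_bound _ (by positivity) fun y => ?_
    refine denseRange_toL2.induction_on y (isClosed_le (by fun_prop) (by fun_prop)) fun x => ?_
    -- A second approximation `f'` of `a`, arbitrarily good, is almost killed by `Ψ`.
    refine le_of_forall_pos_le_add fun δ hδ => ?_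
    set c := ‖Ψ (toCrossSectional x)‖ with hc
    have hc0 : 0 ≤ c := norm_nonneg _
    obtain ⟨f', hf'⟩ := happrox (min ε (δ / (c + 1))) (lt_min hε (by positivity))
    have h1 : ‖leftRep (f - f')‖ ≤ 2 * ε := by
      refine (norm_leftRep_le _).trans ?_
      rw [map_sub, ← sub_sub_sub_cancel_left _ _ a]
      refine (norm_sub_le _ _).trans ?_
      linarith [hf'.trans_le (min_le_left _ _)]
    have h2 : ‖Ψ (toCrossSectional f')‖ ≤ δ / (c + 1) := by
      have h := NonUnitalStarAlgHom.norm_apply_le Ψ (a - toCrossSectional f')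
      rw [map_sub, ha, zero_sub, norm_neg] at h
      exact h.trans (hf'.le.trans (min_le_right _ _))
    have h3 : ‖leftRep f' (toL2 x)‖ ≤ δ := by
      rw [leftRep_toL2, norm_toL2]
      refine (hl2 _).trans ?_
      rw [map_mul, map_mul]
      refine (_root_.norm_mul_le _ _).trans ((mul_le_mul_of_nonneg_right h2 hc0).trans ?_)
      rw [div_mul_eq_mul_div, div_le_iff₀ (by positivity)]
      nlinarith
    have h4 : leftRep f (toL2 x) = leftRep (f - f') (toL2 x) + leftRep f' (toL2 x) := by
      rw [← _root_.add_apply, ← leftRep_add, sub_add_cancel]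
    rw [h4]
    refine (norm_add_le _ _).trans (add_le_add ?_ h3)
    exact (ContinuousLinearMap.le_opNorm _ _).trans
      (mul_le_mul_of_nonneg_right h1 (norm_nonneg _))
  refine norm_le_zero_iff.mp (le_of_forall_pos_le_add fun ε hε => ?_)
  obtain ⟨f, hf⟩ := happrox (ε / 3) (by positivity)
  have h1 := NonUnitalStarAlgHom.norm_apply_le (regularRep B) (a - toCrossSectional f)
  rw [map_sub, regularRep_toCrossSectional] at h1
  have h2 := hbound _ (by positivity) f hf
  have h3 := norm_le_norm_sub_add (regularRep B a) (toReduced f)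
  rw [norm_toReduced] at h3
  linarith

end Representation

/-! ### Aperiodicity -/

theorem unitHom_mul_single {t : G} (d : UnitFibre B) (b : B t) :
    unitHom d * single t b = single t (mul (one_mul t) (d : B 1) b) :=
  single_mul_single (B := B) (one_mul t) d b

theorem single_mul_unitHom {t : G} (b : B t) (d : UnitFibre B) :
    single t b * unitHom d = single t (mul (mul_one t) b (d : B 1)) :=
  single_mul_single (B := B) (mul_one t) b d

theorem single_conj {t : G} (d : UnitFibre B) (b : B t) :
    single t (conj d b) = unitHom d * single t b * unitHom d :=
  ((congrArg (· * unitHom d) (unitHom_mul_single d b)).trans (single_mul_unitHom _ d)).symm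

theorem norm_conj_le_of_eq_mul {t : G} {x d u v : UnitFibre B} (hu : x = u * d) (hv : x = d * v)
    (b : B t) : ‖conj x b‖ ≤ ‖u‖ * ‖conj d b‖ * ‖v‖ := by
  have h : conj x b = mul (mul_one t) (mul (one_mul t) (u : B 1) (conj d b)) (v : B 1) := by
    have h0 : unitHom x * single t b * unitHom x =
        unitHom u * (unitHom d * single t b * unitHom d) * unitHom v := by
      nth_rewrite 1 [hu]
      nth_rewrite 1 [hv]
      simp only [map_mul, _root_.mul_assoc]
    rw [← single_conj, ← single_conj] at h0
    have h1 := h0.trans ((congrArg (· * unitHom v) (unitHom_mul_single u (conj d b))).trans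
      (single_mul_unitHom _ v))
    have h2 := congrArg (fun z : Sections B => z t) h1
    simpa only [single_apply_self] using h2
  rw [h]
  refine (norm_mul_le _ _ _).trans ?_
  exact mul_le_mul_of_nonneg_right (norm_mul_le _ _ _) (norm_nonneg _)

section Cutdown

attribute [local instance] CStarAlgebra.spectralOrder CStarAlgebra.spectralOrderedRing

/-- Aperiodicity, made uniform: a non-zero support subalgebra contains a smaller one on which the
compressions of `b` are uniformly small. It is the support subalgebra of an approximate spectral
projection of a norm-one element that almost annihilates `b`. -/
theorem IsAperiodic.exists_supportSubalgebra_le (hB : IsAperiodic B) {t : G} (ht : t ≠ 1) (b : B t)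
    {e : UnitFibre B} (he : IsSelfAdjoint e) (hne : ∃ y ∈ supportSubalgebra e he, y ≠ 0)
    {ε : ℝ} (hε : 0 < ε) :
    ∃ (e' : UnitFibre B) (he' : IsSelfAdjoint e'),
      (∃ y ∈ supportSubalgebra e' he', y ≠ 0) ∧
      supportSubalgebra e' he' ≤ supportSubalgebra e he ∧
      ∀ x ∈ supportSubalgebra e' he', ‖conj x b‖ ≤ ε * ‖x‖ ^ 2 := by
  have hglb := hB t ht b _ (isHereditarySubalgebra_supportSubalgebra e he) hne
  obtain ⟨r, ⟨d, hd, hdpos, hd1, rfl⟩, -, hlt⟩ :=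
    hglb.exists_between (show (0 : ℝ) < ε / 4 by positivity)
  obtain ⟨hde, hed⟩ := mem_supportSubalgebra.mp hd
  obtain ⟨e', h, k, he', hhd, hdh, hh, hk0, hk1, hk2, -⟩ :=
    exists_spectral_cutoff hdpos.nonneg (s := 1 / 2) (by norm_num) (by rw [hd1]; norm_num)
  refine ⟨e', he', ⟨k, ⟨hk1, hk2⟩, hk0⟩, fun x hx => ?_, fun x hx => ?_⟩
  · obtain ⟨hx1, hx2⟩ := mem_supportSubalgebra.mp hx
    refine mem_supportSubalgebra.mpr ⟨?_, ?_⟩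
    · rw [← hx1, hhd]
      simp only [_root_.mul_assoc, hde]
    · rw [← hx2, hdh]
      simp only [← _root_.mul_assoc, hed]
  · obtain ⟨hx1, hx2⟩ := mem_supportSubalgebra.mp hx
    have hxu : x = (x * h) * d := by rw [_root_.mul_assoc, ← hhd, hx1]
    have hxv : x = d * (h * x) := by rw [← _root_.mul_assoc, ← hdh, hx2]
    have hu : ‖x * h‖ ≤ 2 * ‖x‖ := by
      refine (_root_.norm_mul_le _ _).trans ?_
      nlinarith [norm_nonneg x]
    have hv : ‖h * x‖ ≤ 2 * ‖x‖ := by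
      refine (_root_.norm_mul_le _ _).trans ?_
      nlinarith [norm_nonneg x]
    calc ‖conj x b‖ ≤ ‖x * h‖ * ‖conj d b‖ * ‖h * x‖ := norm_conj_le_of_eq_mul hxu hxv b
      _ ≤ 2 * ‖x‖ * (ε / 4) * (2 * ‖x‖) := by gcongr
      _ = ε * ‖x‖ ^ 2 := by ring

/-- In an aperiodic bundle, compressing a section by suitable elements of the unit fibre leaves only
its coefficient at the unit element, up to a small error. -/
theorem IsAperiodic.exists_compression_le (hB : IsAperiodic B) (f : Sections B) :
    ∀ (e : UnitFibre B) (he : IsSelfAdjoint e), (∃ y ∈ supportSubalgebra e he, y ≠ 0) →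
      ∀ ε : ℝ, 0 < ε → ∃ (e' : UnitFibre B) (he' : IsSelfAdjoint e'),
        (∃ y ∈ supportSubalgebra e' he', y ≠ 0) ∧
        supportSubalgebra e' he' ≤ supportSubalgebra e he ∧
        ∀ x ∈ supportSubalgebra e' he',
          maxSeminorm B (unitHom x * f * unitHom x - unitHom (x * evalUnit f * x)) ≤
            ε * ‖x‖ ^ 2 := by
  induction f using Sections.induction with
  | zero =>
    intro e he hne ε hε
    refine ⟨e, he, hne, le_rfl, fun x _ => ?_⟩
    have h0 : evalUnit (0 : Sections B) = 0 := rfl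
    rw [mul_zero, zero_mul, h0, mul_zero, zero_mul, map_zero, sub_zero, map_zero]
    positivity
  | add f f' ih ih' =>
    intro e he hne ε hε
    obtain ⟨e₁, he₁, hne₁, hle₁, h₁⟩ := ih e he hne (ε / 2) (by positivity)
    obtain ⟨e₂, he₂, hne₂, hle₂, h₂⟩ := ih' e₁ he₁ hne₁ (ε / 2) (by positivity)
    refine ⟨e₂, he₂, hne₂, hle₂.trans hle₁, fun x hx => ?_⟩
    have hsum : unitHom x * (f + f') * unitHom x - unitHom (x * evalUnit (f + f') * x) =
        (unitHom x * f * unitHom x - unitHom (x * evalUnit f * x)) +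
        (unitHom x * f' * unitHom x - unitHom (x * evalUnit f' * x)) := by
      rw [evalUnit_add]
      simp only [_root_.mul_add, _root_.add_mul, map_add]
      abel
    rw [hsum]
    refine (map_add_le_add (maxSeminorm B).toSeminorm _ _).trans ?_
    linarith [h₁ x (hle₂ hx), h₂ x hx]
  | single t b =>
    intro e he hne ε hε
    by_cases ht : t = 1
    · subst ht
      refine ⟨e, he, hne, le_rfl, fun x _ => ?_⟩
      have h1 : unitHom (evalUnit (single 1 b)) = single 1 b :=
        congrArg (single 1) (single_apply_self 1 b)
      rw [map_mul, map_mul, h1, sub_self, map_zero]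
      positivity
    · obtain ⟨e', he', hne', hle, hx'⟩ := hB.exists_supportSubalgebra_le ht b he hne hε
      refine ⟨e', he', hne', hle, fun x hx => ?_⟩
      have h1 : evalUnit (single t b) = 0 := single_apply_ne (Ne.symm ht) b
      rw [h1, mul_zero, zero_mul, map_zero, sub_zero, ← single_conj]
      exact (seminorm_single_le _ _ _).trans (hx' x hx)

variable {D : Type*} [NonUnitalCStarAlgebra D] {Ψ : CrossSectional B →⋆ₙₐ[ℂ] D}

theorem norm_apply_unitHom (hΨ : Function.Injective fun b : UnitFibre B =>
    Ψ (toCrossSectional (unitHom b))) (b : UnitFibre B) :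
    ‖Ψ (toCrossSectional (unitHom b))‖ = ‖b‖ :=
  NonUnitalStarAlgHom.norm_map (Ψ.comp (toCrossSectional.comp unitHom)) hΨ b

theorem IsAperiodic.norm_evalUnit_star_mul_self_le (hB : IsAperiodic B)
    (hΨ : Function.Injective fun b : UnitFibre B => Ψ (toCrossSectional (unitHom b)))
    (h : Sections B) :
    ‖evalUnit (Star.star h * h)‖ ≤ ‖Ψ (toCrossSectional (Star.star h * h))‖ := by
  by_contra! hlt
  set f := Star.star h * h
  set c := ‖Ψ (toCrossSectional f)‖ with hc
  obtain ⟨s, hcs, hsa⟩ := exists_between hlt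
  have hs : 0 < s := (norm_nonneg _).trans_lt hcs
  obtain ⟨e, -, k, he, -, -, -, hk0, hk1, hk2, hea⟩ :=
    exists_spectral_cutoff (inner_self_nonneg' h) hs hsa
  obtain ⟨e', he', ⟨y, hy, hy0⟩, hle, hcomp⟩ :=
    hB.exists_compression_le f e he ⟨k, ⟨hk1, hk2⟩, hk0⟩ ((s - c) / 2) (by linarith)
  set x := Star.star y * y with hxdef
  have hx : x ∈ supportSubalgebra e' he' := mul_mem (star_mem hy) hy
  have hxsa : Star.star x = x := (IsSelfAdjoint.star_mul_self y).star_eq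
  have hx0 : 0 < ‖x‖ := by
    rw [norm_pos_iff, hxdef]
    exact fun h0 => hy0 (CStarRing.star_mul_self_eq_zero_iff y |>.mp h0)
  have h1 := norm_sq_le_of_mul_self_le hs hea (mem_supportSubalgebra.mp (hle hx)).2
  rw [hxsa, ← norm_apply_unitHom hΨ (x * evalUnit f * x)] at h1
  have h2 : ‖Ψ (toCrossSectional (unitHom x * f * unitHom x))‖ ≤ c * ‖x‖ ^ 2 := by
    simp only [map_mul]
    refine (_root_.norm_mul_le _ _).trans ?_
    refine (mul_le_mul_of_nonneg_right (_root_.norm_mul_le _ _) (norm_nonneg _)).trans ?_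
    rw [norm_apply_unitHom hΨ]
    exact le_of_eq (by ring)
  have h3 : ‖Ψ (toCrossSectional (unitHom x * f * unitHom x)) -
      Ψ (toCrossSectional (unitHom (x * evalUnit f * x)))‖ ≤ (s - c) / 2 * ‖x‖ ^ 2 := by
    rw [← map_sub, ← map_sub]
    refine (NonUnitalStarAlgHom.norm_apply_le Ψ _).trans ?_
    rw [norm_toCrossSectional]
    exact hcomp x hx
  have h4 := norm_le_norm_add_norm_sub (Ψ (toCrossSectional (unitHom x * f * unitHom x)))
    (Ψ (toCrossSectional (unitHom (x * evalUnit f * x))))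
  have h5 : 0 < (s - c) / 2 * ‖x‖ ^ 2 := mul_pos (by linarith) (by positivity)
  linarith

end Cutdown

end FellBundle

theorem mainTheorem12 {G : Type*} [Group G] (B : G → Type*) [∀ g, NormedAddCommGroup (B g)]
    [∀ g, NormedSpace ℂ (B g)] [FellBundle B] {H : Type*} [NormedAddCommGroup H]
    [InnerProductSpace ℂ H] [CompleteSpace H]
    (Ψ : FellBundle.CrossSectional B →⋆ₙₐ[ℂ] (H →L[ℂ] H))
    (hΨ : Function.Injective fun b : B 1 =>
      Ψ (FellBundle.toCrossSectional (FellBundle.single 1 b))) :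
    (FellBundle.IsAperiodic B → ∀ a, Ψ a = 0 → FellBundle.regularRep B a = 0) ∧
    List.TFAE [
      ∀ a, Ψ a = 0 → FellBundle.regularRep B a = 0,
      ∀ f : FellBundle.Sections B, ‖f 1‖ ≤ ‖Ψ (FellBundle.toCrossSectional f)‖,
      ∀ f : FellBundle.Sections B, IsPositiveElement (FellBundle.toCrossSectional f) →
        ‖f 1‖ ≤ ‖Ψ (FellBundle.toCrossSectional f)‖] := by
  refine ⟨fun hB a ha => FellBundle.regularRep_eq_zero_of_norm_evalUnit_le Ψ
    (hB.norm_evalUnit_star_mul_self_le hΨ) ha, ?_⟩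
  tfae_have 1 → 2 := fun h f => by
    refine (FellBundle.norm_evalUnit_le_norm_leftRep f).trans ?_
    rw [← FellBundle.norm_toReduced, ← FellBundle.regularRep_toCrossSectional]
    exact norm_apply_le_of_ker_le Ψ (FellBundle.regularRep B) h _
  tfae_have 2 → 3 := fun h f _ => h f
  tfae_have 3 → 1 := fun h a ha =>
    FellBundle.regularRep_eq_zero_of_norm_evalUnit_le Ψ
      (fun x => h _ ⟨FellBundle.toCrossSectional x, by rw [map_mul, map_star]⟩) ha
  tfae_finish
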